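/- **Setting.** A tracial von Neumann algebra $(\mathcal M,\tau)$ is a von Neumann algebra with a normal faithful tracial state; $\|x\|_\tau^2=\tau(x^*x)$. Let $\mathcal M_\infty=\mathcal M\,\overline\otimes\,B(\ell^2(\mathbb Z))$ with trace $\tau_\infty=\tau\otimes\mathrm{Tr}$, and identify $\mathcal M$ with the corner $\mathcal M\otimes E_{11}$ of $\mathcal M_\infty$, with unit $1_{\mathcal M}$. Let $\dim(\mathcal M)\in\mathbb N\cup\{\infty\}$ be the smallest dimension of a Hilbert space on which $\mathcal M$ has a faithful unital $*$-representation (so $\dim M_d(\mathbb C)=d$, and $\dim\mathcal M=\infty$ if $\mathcal M$ is infinite-dimensional). A game $G=(\mathcal X,\mu,\mathcal A,D)$ consists of a finite question set $\mathcal X$, a probability distribution $\mu$ on $\mathcal X\times\mathcal X$, finite answer sets $\mathcal A(x)$ and a decision function $D(x,y,a,b)\in\{0,1\}$ with $D(x,y,a,b)=D(y,x,b,a)$; it is synchronous if $D(x,x,a,b)=0$ whenever $\mu(x,x)>0$ and $a\ne b$. A synchronous strategy on $(\mathcal M,\tau)$ is a family of projective measurements $\{P^x_a\}_{a\in\mathcal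 A(x)}$ in $\mathcal M$, $x\in\mathcal X$. It succeeds with probability $$\sum_{x,y}\tfrac12\big(\mu(x,y)+\mu(y,x)\big)\sum_{a,b}D(x,y,a,b)\,\tau(P^x_aP^y_b).$$ Let $\delta\ge 0$ and let $\nu$ be a measure on $\mathcal X$. A strategy $\{A^x_a\}$ on $(\mathcal M,\tau)$ is $(\delta,\nu)$-close to a strategy $\{B^x_a\}$ on $(\mathcal R,\tau^{\mathcal R})$ if there are a projection $P\in\mathcal M_\infty$ of finite trace, a $*$-isomorphism $\mathcal R\cong P\mathcal M_\infty P$ (used as an identification) carrying $\tau^{\mathcal R}$ to $\tau_\infty/\tau_\infty(P)$, and a partial isometry $w\in P\mathcal M_\infty 1_{\mathcal M}$, such that $$\sum_{x}\nu(x)\sum_a\|A^x_a-w^*B^x_aw\|_\tau^2\le\delta,\qquad \max\{\tau(1_{\mathcal M}-w^*w),\ \tau^{\mathcal R}(P-ww^*)\}\le\delta.$$ For $k\in\mathbb N$, $W\in\{X,Z\}$ and $a\in\mathbb F_2^k$ let $\sigma^W(a)=\bigotimes_{i=1}^k(\sigma^W)^{a_i}\in M_{2^k}(\mathbb C)$ be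 the Pauli observables, and let $\mathrm{tr}=2^{-k}\mathrm{Tr}$. For $\delta:[0,1]\to[0,\infty)$, a $(k,\delta(\varepsilon))$-qubit test is a synchronous game $G$ for which there are sets $S_X,S_Z\subseteq\mathbb F_2^k$, each spanning $\mathbb F_2^k$, and an injection $\phi:(\{X\}\times S_X)\cup(\{Z\}\times S_Z)\to\mathcal X$ with $\mathcal A(\phi(W,a))=\mathbb F_2$ for all $W$ and $a\in S_W$, such that: * (Completeness) there are a tracial von Neumann algebra $(\mathcal N,\tau')$ and a synchronous strategy $\{P^x_a\}$ on $(M_{2^k}(\mathbb C)\otimes\mathcal N,\mathrm{tr}\otimes\tau')$ that succeeds with probability $1$ and satisfies $P^{\phi(W,a)}_0-P^{\phi(W,a)}_1=\sigma^W(a)\otimes 1_{\mathcal N}$ for all $W$ and all $a\in S_W$; * (Soundness) for every $\varepsilon\in[0,1]$, every synchronous strategy on any $(\mathcal M,\tau)$ that succeeds with probability $1-\varepsilon$ is $(\delta(\varepsilon),\mu')$-close to a strategy $\{P^x_a\}$ on some $(M_{2^k}(\mathbb C)\otimes\mathcal N,\mathrm{tr}\otimes\tau')$, with $(\mathcal N,\tau')$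 a tracial von Neumann algebra, such that $P^{\phi(W,a)}_0-P^{\phi(W,a)}_1=\sigma^W(a)\otimes 1_{\mathcal N}$ for all $W$ and all $a\in S_W$. Here $\mu'$ is the renormalized restriction to the image of $\phi$ of the symmetrized marginal $\mu(x)=\sum_{x'}\frac12(\mu(x,x')+\mu(x',x))$. **Proposition.** There is a universal constant $C>0$ such that the following holds. Let $G$ be a $(k,\delta(\varepsilon))$-qubit test, let $\varepsilon\in[0,1]$ be such that $\delta(\varepsilon)<1$, and let $(\mathcal M,\tau)$ be a tracial von Neumann algebra on which $G$ has a synchronous strategy that succeeds with probability $1-\varepsilon$. Then $$\dim(\mathcal M)\ \ge\ \Big(1+C\sqrt{\delta(\varepsilon)}+\frac{\delta(\varepsilon)}{1-\delta(\varepsilon)}\Big)^{-1}2^k .$$ -/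

import Mathlib

open scoped ENNReal NNReal

universe u v w

noncomputable section

namespace QubitTest

/-! ### Tracial von Neumann algebras -/

/-- The von Neumann algebra generated by a set `s` of bounded operators on a Hilbert space:
the double commutant of `s ∪ s*`. -/
def generatedVN {H : Type*} [NormedAddCommGroup H] [InnerProductSpace ℂ H] [CompleteSpace H]
    (s : Set (H →L[ℂ] H)) : VonNeumannAlgebra H where
  toStarSubalgebra := StarSubalgebra.centralizer ℂ
    (StarSubalgebra.centralizer ℂ s : Set (H →L[ℂ] H))
  centralizer_centralizer' := by
    change Set.centralizer (Set.centralizer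
      ((StarSubalgebra.centralizer ℂ (StarSubalgebra.centralizer ℂ s : Set (H →L[ℂ] H)) :
        StarSubalgebra ℂ (H →L[ℂ] H)) : Set (H →L[ℂ] H))) = _
    rw [StarSubalgebra.coe_centralizer_centralizer, Set.centralizer_centralizer_centralizer]
    exact (StarSubalgebra.coe_centralizer_centralizer ℂ s).symm

/-- A tracial von Neumann algebra `(M, τ)`: a von Neumann algebra `M` of bounded operators on a
Hilbert space `H`, with a normal faithful tracial state `τ` on `M`. -/
structure TracialVN where
  H : Type*
  [instNACG : NormedAddCommGroup H]
  [instIPS : InnerProductSpace ℂ H]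
  [instComplete : CompleteSpace H]
  alg : VonNeumannAlgebra H
  /-- The trace. -/
  tr : alg.toStarSubalgebra →ₗ[ℂ] ℂ
  tr_one : tr 1 = 1
  tr_nonneg : ∀ x, 0 ≤ (tr (star x * x)).re ∧ (tr (star x * x)).im = 0
  tr_faithful : ∀ x, tr (star x * x) = 0 → x = 0
  tr_mul_comm : ∀ x y, tr (x * y) = tr (y * x)
  /-- Normality: `τ` preserves suprema of directed families of positive elements. -/
  tr_normal : ∀ (D : Set alg.toStarSubalgebra) (s : alg.toStarSubalgebra), D.Nonempty →
    DirectedOn (fun x y : alg.toStarSubalgebra => (x : H →L[ℂ] H) ≤ (y : H →L[ℂ] H)) D →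
    (∀ x ∈ D, (0 : H →L[ℂ] H) ≤ (x : H →L[ℂ] H)) →
    IsLUB (Subtype.val '' D) (s : H →L[ℂ] H) →
    IsLUB ((fun x => (tr x).re) '' D) (tr s).re

attribute [instance] TracialVN.instNACG TracialVN.instIPS TracialVN.instComplete

namespace TracialVN

variable (M : TracialVN.{u})

/-- The underlying `*`-algebra of a tracial von Neumann algebra. -/
abbrev Alg : Type u := M.alg.toStarSubalgebra

/-- The tracial norm squared, `‖x‖_τ² = τ(x* x)`. -/
def normSq (x : M.Alg) : ℝ := (M.tr (star x * x)).re

/-- The dimension of `M`, as the smallest dimension of a Hilbert space on which `M` acts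
faithfully: the least `n` such that `M` is `*`-isomorphic to a unital `*`-subalgebra of `M_n(ℂ)`,
and `∞` if there is none (that is, if `M` is infinite-dimensional). For `M = M_d(ℂ)` it is `d`,
and for `M = ⨁ M_{d_i}(ℂ)` it is `∑ d_i`. -/
def dim : ℕ∞ :=
  ⨅ n ∈ {n : ℕ | ∃ f : M.Alg →⋆ₐ[ℂ] Matrix (Fin n) (Fin n) ℂ, Function.Injective f}, (n : ℕ∞)

/-- The Hilbert space `H ⊗ ℓ²(ℤ)`, realised as `ℓ²(ℤ; H)`. -/
abbrev HInf : Type u := lp (fun _ : ℤ => M.H) 2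

/-- The `(i, j)` matrix entry in `B(H)` of an operator on `ℓ²(ℤ; H)`. -/
def entry (T : M.HInf →L[ℂ] M.HInf) (i j : ℤ) : M.H →L[ℂ] M.H :=
  (lp.evalCLM ℂ (fun _ : ℤ => M.H) 2 i).comp
    (T.comp (lp.singleContinuousLinearMap ℂ (fun _ : ℤ => M.H) 2 j))

/-- The elementary tensor `x ⊗ E_{ij}` on `ℓ²(ℤ; H)`, with `E_{ij} = e_i e_j*`. -/
def elem (x : M.H →L[ℂ] M.H) (i j : ℤ) : M.HInf →L[ℂ] M.HInf :=
  (lp.singleContinuousLinearMap ℂ (fun _ : ℤ => M.H) 2 i).comp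
    (x.comp (lp.evalCLM ℂ (fun _ : ℤ => M.H) 2 j))

/-- `M_∞ = M ⊗̄ B(ℓ²(ℤ))`, the von Neumann algebra on `ℓ²(ℤ; H)` generated by the elementary
tensors `x ⊗ E_{ij}`, `x ∈ M` (the `E_{ij}` generate `B(ℓ²(ℤ))`). -/
def inf : VonNeumannAlgebra M.HInf :=
  generatedVN {T | ∃ x ∈ M.alg, ∃ i j : ℤ, T = M.elem x i j}

/-- The underlying `*`-algebra of `M_∞`. -/
abbrev AlgInf : Type u := M.inf.toStarSubalgebra

/-- The operator `y ⊗ 1` on `ℓ²(ℤ; H)`. -/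
def diag (y : M.H →L[ℂ] M.H) : M.HInf →L[ℂ] M.HInf :=
  have key : ∀ (f : M.HInf) (i : ℤ), ‖y (f i)‖ ≤ ‖((‖y‖ : ℂ) • f) i‖ := fun f i => by
    rw [lp.coeFn_smul, Pi.smul_apply, norm_smul]
    simpa using y.le_opNorm (f i)
  LinearMap.mkContinuous
    { toFun := fun f => ⟨fun i => y (f i), (lp.memℓp ((‖y‖ : ℂ) • f)).mono' (key f)⟩
      map_add' := fun f g => by ext i; exact map_add y _ _
      map_smul' := fun c f => by ext i; exact map_smul y _ _ }
    ‖y‖ (fun f => by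
      refine (lp.norm_mono (by norm_num) (y := (‖y‖ : ℂ) • f) (key f)).trans ?_
      rw [norm_smul]; simp)

theorem diag_apply (y : M.H →L[ℂ] M.H) (f : M.HInf) (i : ℤ) : M.diag y f i = y (f i) := rfl

theorem elem_apply (x : M.H →L[ℂ] M.H) (i j : ℤ) (f : M.HInf) :
    M.elem x i j f = lp.single 2 i (x (f j)) := rfl

theorem entry_apply (T : M.HInf →L[ℂ] M.HInf) (i j : ℤ) (v : M.H) :
    M.entry T i j v = T (lp.single 2 j v) i := rfl

theorem diag_single (y : M.H →L[ℂ] M.H) (j : ℤ) (v : M.H) :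
    M.diag y (lp.single 2 j v) = lp.single 2 j (y v) := by
  ext i
  rw [diag_apply, lp.single_apply, lp.single_apply]
  by_cases h : i = j
  · subst h; simp
  · simp [h]

theorem diag_comm_elem {x y : M.H →L[ℂ] M.H} (h : x * y = y * x) (i j : ℤ) :
    M.elem x i j * M.diag y = M.diag y * M.elem x i j := by
  ext1 f
  change M.elem x i j (M.diag y f) = M.diag y (M.elem x i j f)
  rw [elem_apply, elem_apply, diag_single, diag_apply]
  exact congrArg (lp.single 2 i) (DFunLike.congr_fun h (f j))

/-- The matrix entries of an element of `M_∞` belong to `M`. -/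
theorem entry_mem {T : M.HInf →L[ℂ] M.HInf} (hT : T ∈ M.inf.toStarSubalgebra) (i j : ℤ) :
    M.entry T i j ∈ M.alg.toStarSubalgebra := by
  have h2 : T ∈ Set.centralizer ((StarSubalgebra.centralizer ℂ
      {T | ∃ x ∈ M.alg, ∃ i j : ℤ, T = M.elem x i j} :
        StarSubalgebra ℂ (M.HInf →L[ℂ] M.HInf)) : Set (M.HInf →L[ℂ] M.HInf)) := by
    have hT' := (StarSubalgebra.mem_centralizer_iff ℂ).1 hT
    exact fun g hg => (hT' g hg).1
  change M.entry T i j ∈ (M.alg : Set (M.H →L[ℂ] M.H))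
  rw [← M.alg.centralizer_centralizer]
  intro y hy
  have hy' : M.diag y ∈ StarSubalgebra.centralizer ℂ
      {T | ∃ x ∈ M.alg, ∃ i j : ℤ, T = M.elem x i j} := by
    have star_elem : ∀ (x : M.H →L[ℂ] M.H) (i j : ℤ), star (M.elem x i j) = M.elem (star x) j i := by
      intro x i j
      refine ((ContinuousLinearMap.eq_adjoint_iff _ _).2 fun f g => ?_).symm
      rw [elem_apply, elem_apply, lp.inner_single_left, lp.inner_single_right]
      exact ContinuousLinearMap.adjoint_inner_left x _ _
    rw [StarSubalgebra.mem_centralizer_iff]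
    rintro _ ⟨x, hx, i, j, rfl⟩
    refine ⟨M.diag_comm_elem (hy x hx) i j, ?_⟩
    rw [star_elem]
    exact M.diag_comm_elem (hy _ (star_mem hx)) j i
  have hc := h2 _ hy'
  ext1 v
  change y (M.entry T i j v) = M.entry T i j (y v)
  rw [entry_apply, entry_apply, ← diag_single, ← diag_apply]
  have hv : M.diag y (T (lp.single 2 j v)) = T (M.diag y (lp.single 2 j v)) :=
    congrArg (fun S : M.HInf →L[ℂ] M.HInf => S (lp.single 2 j v)) hc
  exact congrArg (fun f : M.HInf => f i) hv

/-- The matrix entries of an element of `M_∞`, as elements of `M`. -/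
def entryAlg (T : M.AlgInf) (i j : ℤ) : M.Alg := ⟨M.entry T.1 i j, M.entry_mem T.2 i j⟩

/-- The trace `τ_∞ = τ ⊗ Tr` on `M_∞`, `τ_∞(T) = ∑_i τ(T_{ii})`; it is used below only on
`P M_∞ P` for projections `P` of finite trace, where the sum converges absolutely. -/
def trInf (T : M.AlgInf) : ℂ := ∑' i : ℤ, M.tr (M.entryAlg T i i)

/-- A projection `P ∈ M_∞` of finite trace. -/
def IsFiniteProj (P : M.AlgInf) : Prop :=
  IsStarProjection P ∧ Summable fun i : ℤ => M.tr (M.entryAlg P i i)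

theorem elem_mem {x : M.H →L[ℂ] M.H} (hx : x ∈ M.alg) (i j : ℤ) :
    M.elem x i j ∈ M.inf.toStarSubalgebra := by
  refine (StarSubalgebra.mem_centralizer_iff ℂ).2 fun g hg => ?_
  have h1 : ∀ g ∈ StarSubalgebra.centralizer ℂ {T | ∃ x ∈ M.alg, ∃ i j : ℤ, T = M.elem x i j},
      g * M.elem x i j = M.elem x i j * g := fun g hg =>
    (((StarSubalgebra.mem_centralizer_iff ℂ).1 hg) _ ⟨x, hx, i, j, rfl⟩).1.symm
  exact ⟨h1 g hg, h1 _ (star_mem hg)⟩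

/-- The unit `1_M = 1 ⊗ E_{11}` of `M`, where `M` is identified with the corner `M ⊗ E_{11}` of
`M_∞`. -/
def cornerUnit : M.AlgInf := ⟨M.elem 1 1 1, M.elem_mem (one_mem M.alg) 1 1⟩

/-- The identification of the corner `1_M M_∞ 1_M = M ⊗ E_{11}` with `M`. -/
def fromCorner (T : M.AlgInf) : M.Alg := M.entryAlg T 1 1

/-- A partial isometry `w ∈ P M_∞ 1_M`. -/
def IsCornerPartialIsometry (P w : M.AlgInf) : Prop :=
  w * star w * w = w ∧ P * w = w ∧ w * M.cornerUnit = w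

end TracialVN

/-! ### Games and synchronous strategies -/

/-- A game `(𝒳, μ, 𝒜, D)`. The predicate `D` is extended from the support of `μ` to all pairs of
questions, keeping it symmetric; the value of a strategy does not depend on the extension. -/
structure Game (𝒳 : Type v) [Fintype 𝒳] (𝒜 : 𝒳 → Type w) where
  μ : 𝒳 → 𝒳 → ℝ
  μ_nonneg : ∀ x y, 0 ≤ μ x y
  μ_sum : ∑ x, ∑ y, μ x y = 1
  D : ∀ x y, 𝒜 x → 𝒜 y → Bool
  D_symm : ∀ x y a b, D x y a b = D y x b a

/-- A synchronous strategy with values in a `*`-algebra `R`: a projective measurement for each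
question. -/
structure SyncStrategy {𝒳 : Type v} (𝒜 : 𝒳 → Type w) [∀ x, Fintype (𝒜 x)]
    (R : Type u) [Ring R] [StarRing R] where
  P : ∀ x, 𝒜 x → R
  proj : ∀ x a, IsStarProjection (P x a)
  sum_eq_one : ∀ x, ∑ a, P x a = 1

/-- The value of a strategy, relative to a trace `τ` on `R`. -/
def Game.value {𝒳 : Type v} [Fintype 𝒳] {𝒜 : 𝒳 → Type w} [∀ x, Fintype (𝒜 x)]
    (G : Game 𝒳 𝒜) {R : Type u} [Ring R] [StarRing R] (τ : R → ℂ) (S : SyncStrategy 𝒜 R) : ℝ :=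
  ∑ x, ∑ y, (G.μ x y + G.μ y x) / 2 *
    ∑ a, ∑ b, if G.D x y a b then (τ (S.P x a * S.P y b)).re else 0

/-- The symmetrized marginal of `μ`. -/
def Game.marginal {𝒳 : Type v} [Fintype 𝒳] {𝒜 : 𝒳 → Type w} (G : Game 𝒳 𝒜) (x : 𝒳) : ℝ :=
  ∑ x', (G.μ x x' + G.μ x' x) / 2

/-- Different answers to the same question lose, whenever that question pair is asked. -/
def Game.IsSynchronous {𝒳 : Type v} [Fintype 𝒳] {𝒜 : 𝒳 → Type w} (G : Game 𝒳 𝒜) : Prop :=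
  ∀ x, 0 < G.μ x x → ∀ a b, a ≠ b → G.D x x a b = false

/-- The restriction of the marginal of `μ` to a set of questions, renormalized. -/
def Game.restrictedMarginal {𝒳 : Type v} [Fintype 𝒳] {𝒜 : 𝒳 → Type w} (G : Game 𝒳 𝒜)
    (s : Set 𝒳) (x : 𝒳) : ℝ :=
  s.indicator G.marginal x / ∑ x', s.indicator G.marginal x'

/-- A strategy `A` on `(M, τ)` and a strategy `B` on `(R, τ_R)` are `(δ, μ)`-close: there are a
projection `P ∈ M_∞` of finite trace, an identification (`*`-isomorphism) `θ` of `R` with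
`P M_∞ P` under which `τ_R = τ_∞ / τ_∞(P)`, and a partial isometry `w ∈ P M_∞ 1_M` with
`E_{x ∼ μ} ∑_a ‖A^x_a - w* B^x_a w‖_τ² ≤ δ`, `τ(1 - w* w) ≤ δ` and `τ_R(P - w w*) ≤ δ`. -/
def Close {𝒳 : Type v} [Fintype 𝒳] {𝒜 : 𝒳 → Type w} [∀ x, Fintype (𝒜 x)] (M : TracialVN.{u})
    {R : Type u} [Ring R] [StarRing R] [Algebra ℂ R] (τR : R → ℂ) (δ : ℝ) (μ : 𝒳 → ℝ)
    (A : SyncStrategy 𝒜 M.Alg) (B : SyncStrategy 𝒜 R) : Prop :=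
  ∃ (P w : M.AlgInf) (θ : R →⋆ₙₐ[ℂ] M.AlgInf),
    M.IsFiniteProj P ∧
    Function.Injective θ ∧
    Set.range θ = {T | ∃ T₀, T = P * T₀ * P} ∧
    (∀ r, τR r = M.trInf (θ r) / M.trInf P) ∧
    M.IsCornerPartialIsometry P w ∧
    ∑ x, μ x * ∑ a, M.normSq (A.P x a - M.fromCorner (star w * θ (B.P x a) * w)) ≤ δ ∧
    (M.tr (1 - M.fromCorner (star w * w))).re ≤ δ ∧
    (M.trInf (P - w * star w) / M.trInf P).re ≤ δ

/-! ### Qubit tests -/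

/-- The two labels `X` and `Z`. -/
inductive Label where
  | X
  | Z

/-- The one-qubit Pauli matrices. -/
def pauli₁ : Label → Matrix (Fin 2) (Fin 2) ℂ
  | .X => !![0, 1; 1, 0]
  | .Z => !![1, 0; 0, -1]

/-- The computational basis of `(ℂ²)^{⊗ k}`. -/
abbrev Idx (k : ℕ) : Type := Fin k → Fin 2

/-- The Pauli observable `σ^W(a) = ⨂_i (σ^W)^{a_i}` on `(ℂ²)^{⊗ k}`. -/
def pauli {k : ℕ} (W : Label) (a : Fin k → ZMod 2) : Matrix (Idx k) (Idx k) ℂ :=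
  Matrix.of fun s t => ∏ i, (pauli₁ W ^ (a i).val) (s i) (t i)

/-- The algebra `M_{2^k}(ℂ) ⊗ N`, as matrices with entries in `N`. -/
abbrev QubitAlg (k : ℕ) (N : TracialVN.{u}) : Type u := Matrix (Idx k) (Idx k) N.Alg

/-- The trace `tr ⊗ τ'` on `M_{2^k}(ℂ) ⊗ N`, with `tr = 2^{-k} Tr`. -/
def qubitTr (k : ℕ) (N : TracialVN.{u}) (x : QubitAlg k N) : ℂ :=
  (2 ^ k : ℂ)⁻¹ * N.tr x.trace

/-- `σ^W(a) ⊗ 1_N`. -/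
def pauliTensorOne {k : ℕ} (N : TracialVN.{u}) (W : Label) (a : Fin k → ZMod 2) : QubitAlg k N :=
  (pauli W a).map (algebraMap ℂ N.Alg)

/-- The condition that the observable `P^{φ(W,a)}_0 - P^{φ(W,a)}_1` equals `σ^W(a) ⊗ 1_N` for all
`W ∈ {X, Z}` and `a ∈ S_W`. Here `e` identifies the answer sets `𝒜(φ(W,a))` with `𝔽₂`. -/
def HasPauliObservables {𝒳 : Type v} {𝒜 : 𝒳 → Type w} [∀ x, Fintype (𝒜 x)] {k : ℕ}
    {S : Label → Set (Fin k → ZMod 2)} (φ : (Σ W, S W) → 𝒳) (e : ∀ q, 𝒜 (φ q) ≃ ZMod 2)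
    (N : TracialVN.{u}) (B : SyncStrategy 𝒜 (QubitAlg k N)) : Prop :=
  ∀ q : Σ W, S W,
    B.P (φ q) ((e q).symm 0) - B.P (φ q) ((e q).symm 1) = pauliTensorOne N q.1 q.2.1

/-- `(k, δ(ε))`-qubit tests. -/
def Game.IsQubitTest {𝒳 : Type v} [Fintype 𝒳] {𝒜 : 𝒳 → Type w} [∀ x, Fintype (𝒜 x)]
    (G : Game 𝒳 𝒜) (k : ℕ) (δ : unitInterval → ℝ≥0) : Prop :=
  G.IsSynchronous ∧
  ∃ (S : Label → Set (Fin k → ZMod 2)) (φ : (Σ W, S W) → 𝒳) (e : ∀ q, 𝒜 (φ q) ≃ ZMod 2),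
    (∀ W, Submodule.span (ZMod 2) (S W) = ⊤) ∧
    Function.Injective φ ∧
    -- completeness
    (∃ (N : TracialVN.{u}) (B : SyncStrategy 𝒜 (QubitAlg k N)),
      G.value (qubitTr k N) B = 1 ∧ HasPauliObservables φ e N B) ∧
    -- soundness
    (∀ (M : TracialVN.{u}) (A : SyncStrategy 𝒜 M.Alg) (ε : unitInterval),
      G.value M.tr A = 1 - (ε : ℝ) →
      ∃ (N : TracialVN.{u}) (B : SyncStrategy 𝒜 (QubitAlg k N)),
        HasPauliObservables φ e N B ∧
        Close M (qubitTr k N) (δ ε) (G.restrictedMarginal (Set.range φ)) A B)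

end QubitTest

end

open QubitTest

/-! Let `f` be a faithful representation of `M` on `ℂⁿ`, and let `P`, `w`, `θ` be given by
soundness. Write `Λ = τ_∞(P)` and `Q = w* w ∈ M`. The images under `θ` of the diagonal matrix units
split `P` into `2^k` mutually equivalent projections, each of trace `Λ / 2^k`.

Let `e ≤ Q` be a minimal projection of `M`. Then `w e ≠ 0`, so some block of `w e` is nonzero; moved
by a matrix unit, it becomes a nonzero `u` from `e` into one fixed block. Minimality makes `u* u` a
scalar multiple of `e`, so a rescaled `u u*` is a subprojection of that block with trace `τ(e)`.
Hence `τ(e) ≤ Λ / 2^k` (`tr_le_tsum_diagTr_of_ne_zero`). Each minimal projection removed from `Q`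
lowers the rank under `f`, so at most `n` of them exhaust `Q`, and `τ(Q) ≤ n Λ / 2^k`
(`tr_initial_le`).

On the other side, `τ(Q) = τ_∞(w w*) ≥ (1 - δ) Λ` (`trInf_sub_final`). Cancelling `Λ > 0` leaves
`2^k (1 - δ) ≤ n`, and `(1 - δ)⁻¹ = 1 + δ / (1 - δ)`. The term `C √δ` in the stated bound is
therefore slack. -/

namespace QubitTest

/-! ### Ranks and eigenvectors of complex matrices. -/

section MatrixRank

variable {n : Type*} [Fintype n]

/-- The rank of a matrix drops when its kernel grows. -/
theorem rank_lt_rank_of_ker {A B : Matrix n n ℂ} (hAB : ∀ v, A.mulVec v = 0 → B.mulVec v = 0)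
    {v : n → ℂ} (hB : B.mulVec v = 0) (hA : A.mulVec v ≠ 0) : B.rank < A.rank := by
  have hlt : LinearMap.ker A.mulVecLin < LinearMap.ker B.mulVecLin := by
    refine lt_of_le_of_ne (fun x hx => by simpa using hAB x (by simpa using hx)) fun h => hA ?_
    have : v ∈ LinearMap.ker A.mulVecLin := h ▸ (by simpa using hB)
    simpa using this
  have h1 := Submodule.finrank_lt_finrank_of_lt hlt
  have h2 := A.mulVecLin.finrank_range_add_finrank_ker
  have h3 := B.mulVecLin.finrank_range_add_finrank_ker
  change Module.finrank ℂ (LinearMap.range B.mulVecLin) <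
    Module.finrank ℂ (LinearMap.range A.mulVecLin)
  omega

theorem exists_mulVec_ne_zero {A : Matrix n n ℂ} (h : A ≠ 0) : ∃ v, A.mulVec v ≠ 0 := by
  classical
  by_contra! hv
  exact h (Matrix.ext_of_mulVec_single fun i => by rw [hv, Matrix.zero_mulVec])

/-- A nonzero Hermitian matrix has an eigenvector with nonzero real eigenvalue. -/
theorem exists_eigenvector_ne_zero [DecidableEq n] {A : Matrix n n ℂ} (hA : A.IsHermitian) (h0 : A ≠ 0) :
    ∃ (c : ℝ) (v : n → ℂ), c ≠ 0 ∧ v ≠ 0 ∧ A.mulVec v = (c : ℂ) • v := by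
  by_contra! h
  refine h0 (hA.eigenvalues_eq_zero_iff.1 (funext fun i => ?_))
  by_contra hi
  refine h (hA.eigenvalues i) (hA.eigenvectorBasis i) hi (fun h' => ?_) ?_
  · exact hA.eigenvectorBasis.toBasis.ne_zero i (by ext j; simpa using congrFun h' j)
  · simpa using hA.mulVec_eigenvectorBasis i

end MatrixRank

/-! ### Minimal projections in a `*`-algebra of matrices. -/

section MinimalProjection

variable {R : Type*} [Ring R] [StarRing R] [Algebra ℂ R] {n : ℕ}
  (f : R →⋆ₐ[ℂ] Matrix (Fin n) (Fin n) ℂ)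

/-- The kernel of `f z` lies in that of `f y` because `y = y z`, and subtracting `c z` adds the
vector `v` to the kernel. -/
theorem rank_sub_smul_lt {y z : R} {c : ℝ} {v : Fin n → ℂ} (hv : v ≠ 0)
    (hy : (f y).mulVec v = (c : ℂ) • v) (hz : (f z).mulVec v = v)
    (hyz : y * z = y) : (f (y - (c : ℂ) • z)).rank < (f z).rank := by
  refine rank_lt_rank_of_ker (v := v) (fun x hx => ?_) ?_ ?_
  · have : (f y).mulVec x = 0 := by
      rw [← hyz, map_mul, ← Matrix.mulVec_mulVec, hx, Matrix.mulVec_zero]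
    rw [map_sub, map_smul, Matrix.sub_mulVec, Matrix.smul_mulVec, this, hx]; simp
  · rw [map_sub, map_smul, Matrix.sub_mulVec, Matrix.smul_mulVec, hy, hz, sub_self]
  · rwa [hz]

variable {f}

/-- In a `*`-algebra of matrices, every nonzero projection dominates a nonzero projection `e`
whose corner has only scalar self-adjoint elements. -/
theorem exists_minimal_projection [StarModule ℂ R] (hf : Function.Injective f) {q : R} (hq : IsStarProjection q)
    (hq0 : q ≠ 0) :
    ∃ e : R, IsStarProjection e ∧ e ≠ 0 ∧ q * e = e ∧
      ∀ b, IsSelfAdjoint b → b * e = b → e * b = b → ∃ c : ℝ, b = (c : ℂ) • e := by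
  -- The corner `q R q` contains `q`, so it has a nonzero element `x` of least rank; anything in the
  -- corner of smaller rank is zero.
  have hne : ∃ m, ∃ x : R, x ≠ 0 ∧ q * x = x ∧ x * q = x ∧ (f x).rank = m :=
    ⟨_, q, hq0, hq.isIdempotentElem, hq.isIdempotentElem, rfl⟩
  classical
  obtain ⟨x, hx0, hqx, hxq, hxr⟩ := Nat.find_spec hne
  have hmin : ∀ y : R, q * y = y → y * q = y → (f y).rank < (f x).rank → y = 0 := by
    intro y h1 h2 h3
    by_contra h0
    exact Nat.find_min hne (hxr ▸ h3) ⟨y, h0, h1, h2, rfl⟩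
  have hqs : star q = q := hq.isSelfAdjoint
  have hsx : star x * q = star x := by rw [← hqs, ← star_mul, hqx]
  have hqsx : q * star x = star x := by rw [← hqs, ← star_mul, hxq]
  have hf0 : ∀ y : R, y ≠ 0 → f y ≠ 0 := fun y h h' => h (hf (by rw [h', map_zero]))
  have herm : ∀ y : R, IsSelfAdjoint y → (f y).IsHermitian := fun y h => by
    change star (f y) = f y
    rw [← map_star, h.star_eq]
  set y := star x * x with hy
  have hys : IsSelfAdjoint y := IsSelfAdjoint.star_mul_self x
  have hy0 : y ≠ 0 := fun h => hf0 x hx0 <| by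
    have : f (star x * x) = 0 := by rw [← hy, h, map_zero]
    rw [map_mul, map_star, Matrix.star_eq_conjTranspose] at this
    open scoped ComplexOrder in exact Matrix.conjTranspose_mul_self_eq_zero.1 this
  have hqy : q * y = y := by rw [hy, ← mul_assoc, hqsx]
  have hyq : y * q = y := by rw [hy, mul_assoc, hxq]
  have hyr : (f y).rank ≤ (f x).rank := by
    rw [hy, map_mul]; exact Matrix.rank_mul_le_right _ _
  obtain ⟨c, v, hc, hv, hcv⟩ := exists_eigenvector_ne_zero (herm y hys) (hf0 y hy0)
  have hcC : (c : ℂ) ≠ 0 := by exact_mod_cast hc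
  have hfy : f (y * y - (c : ℂ) • y) = f y * f y - (c : ℂ) • f y := by
    rw [map_sub, map_mul, map_smul]
  -- The element `y² - c y` kills the eigenvector `v`, which `y` does not, so its rank is below the
  -- minimum and it vanishes. Hence `c⁻¹ y` is idempotent.
  have hyy : y * y = (c : ℂ) • y := by
    refine sub_eq_zero.1 (hmin _ ?_ ?_ (lt_of_lt_of_le ?_ hyr))
    · rw [mul_sub, mul_smul_comm, ← mul_assoc, hqy]
    · rw [sub_mul, smul_mul_assoc, mul_assoc, hyq]
    · refine rank_lt_rank_of_ker (v := v) (fun w hw => ?_) ?_ ?_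
      · rw [hfy, Matrix.sub_mulVec, Matrix.smul_mulVec, ← Matrix.mulVec_mulVec, hw]; simp
      · rw [hfy, Matrix.sub_mulVec, Matrix.smul_mulVec, ← Matrix.mulVec_mulVec, hcv,
          Matrix.mulVec_smul, hcv, sub_self]
      · rw [hcv]; exact smul_ne_zero hcC hv
  set e := (c : ℂ)⁻¹ • y with he
  have hes : IsSelfAdjoint e := by
    rw [he, isSelfAdjoint_iff, star_smul, hys.star_eq]; simp
  have hee : e * e = e := by
    rw [he, smul_mul_smul_comm, hyy, smul_smul]; congr 1; field_simp
  have hqe : q * e = e := by rw [he, mul_smul_comm, hqy]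
  have heq : e * q = e := by rw [he, smul_mul_assoc, hyq]
  have her : (f e).rank ≤ (f x).rank := by
    refine le_trans ?_ hyr
    have : f e = f ((c : ℂ)⁻¹ • 1) * f y := by rw [← map_mul, smul_mul_assoc, one_mul]
    rw [this]; exact Matrix.rank_mul_le_right _ _
  refine ⟨e, ⟨hee, hes⟩, smul_ne_zero (inv_ne_zero hcC) hy0, hqe, fun b hb hbe heb => ?_⟩
  rcases eq_or_ne b 0 with rfl | hb0
  · exact ⟨0, by simp⟩
  obtain ⟨d, u, hd, hu, hdu⟩ := exists_eigenvector_ne_zero (herm b hb) (hf0 b hb0)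
  have hdC : (d : ℂ) ≠ 0 := by exact_mod_cast hd
  -- Least rank again: `b - d e` kills an eigenvector `u` of `b` that `e` fixes.
  refine ⟨d, sub_eq_zero.1 (hmin _ ?_ ?_ (lt_of_lt_of_le ?_ her))⟩
  · rw [mul_sub, mul_smul_comm, hqe, ← heb, ← mul_assoc, hqe]
  · rw [sub_mul, smul_mul_assoc, heq, ← hbe, mul_assoc, heq]
  · refine rank_sub_smul_lt f hu hdu ?_ hbe
    have h1 : u = (d : ℂ)⁻¹ • (f b).mulVec u := by rw [hdu, smul_smul, inv_mul_cancel₀ hdC, one_smul]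
    rw [h1, Matrix.mulVec_smul, Matrix.mulVec_mulVec, ← map_mul, heb]

/-- A functional that is at most `t` on some nonzero subprojection of every nonzero subprojection
of `Q` is at most `rank q * t` on every subprojection `q` of `Q`. -/
theorem le_rank_mul_of_exists_subprojection (hf : Function.Injective f) (τ : R →+ ℝ) (t : ℝ)
    {Q : R} (h : ∀ q, IsStarProjection q → q ≠ 0 → Q * q = q →
      ∃ e, IsStarProjection e ∧ e ≠ 0 ∧ q * e = e ∧ τ e ≤ t) (ht : 0 ≤ t) :
    ∀ q, IsStarProjection q → Q * q = q → τ q ≤ (f q).rank * t := by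
  suffices H : ∀ (m : ℕ) (q : R), (f q).rank ≤ m → IsStarProjection q → Q * q = q →
      τ q ≤ m * t from fun q => H _ q le_rfl
  intro m
  induction m with
  | zero =>
    intro q hr hq hQ
    have h0 : q = 0 := by
      by_contra hq0
      obtain ⟨v, hv⟩ := exists_mulVec_ne_zero (A := f q) fun h' => hq0 (hf (by rw [h', map_zero]))
      have := rank_lt_rank_of_ker (A := f q) (B := 0) (by simp) (Matrix.zero_mulVec v) hv
      omega
    simp [h0]
  | succ m ih =>
    intro q hr hq hQ
    rcases eq_or_ne q 0 with rfl | hq0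
    · rw [map_zero]; positivity
    obtain ⟨e, he, he0, hqe, het⟩ := h q hq hq0 hQ
    have heq : e * q = e := by
      have := congrArg star hqe
      rwa [star_mul, he.isSelfAdjoint.star_eq, hq.isSelfAdjoint.star_eq] at this
    have hproj : IsStarProjection (q - e) := by
      refine ⟨?_, hq.isSelfAdjoint.sub he.isSelfAdjoint⟩
      change (q - e) * (q - e) = q - e
      rw [mul_sub, sub_mul, sub_mul, hqe, heq, hq.isIdempotentElem.eq, he.isIdempotentElem.eq,
        sub_self, sub_zero]
    obtain ⟨v, hv⟩ := exists_mulVec_ne_zero (A := f e) fun h' => he0 (hf (by rw [h', map_zero]))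
    -- A nonzero vector in the range of `f e` is killed by `f (q - e)` and fixed by `f q`.
    have hlt : (f (q - e)).rank < (f q).rank := by
      refine rank_lt_rank_of_ker (v := (f e).mulVec v) (fun w hw => ?_) ?_ ?_
      · have : q - e = (1 - e) * q := by rw [sub_mul, one_mul, heq]
        rw [this, map_mul, ← Matrix.mulVec_mulVec, hw, Matrix.mulVec_zero]
      · rw [Matrix.mulVec_mulVec, ← map_mul, sub_mul, hqe, he.isIdempotentElem.eq, sub_self,
          map_zero, Matrix.zero_mulVec]
      · rwa [Matrix.mulVec_mulVec, ← map_mul, hqe]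
    have := ih (q - e) (by omega) hproj (by rw [mul_sub, hQ, ← hqe, ← mul_assoc, hQ])
    rw [map_sub] at this
    push_cast
    linarith

end MinimalProjection


/-! ### Matrix entries and the trace on `M_∞`. -/

/-- Together with its converse below, this turns Loewner-order statements about columns into
inequalities between real series. -/
theorem isPositive_of_inner_eq_ofReal {H : Type*} [NormedAddCommGroup H] [InnerProductSpace ℂ H]
    {A : H →L[ℂ] H} (r : H → ℝ) (h : ∀ x, inner ℂ (A x) x = (r x : ℂ)) (hr : ∀ x, 0 ≤ r x) :
    A.IsPositive :=
  (ContinuousLinearMap.isPositive_iff_complex _).2 fun x => by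
    rw [h]; exact ⟨rfl, hr x⟩

theorem _root_.ContinuousLinearMap.IsPositive.nonneg_of_inner_eq_ofReal {H : Type*}
    [NormedAddCommGroup H] [InnerProductSpace ℂ H] {A : H →L[ℂ] H} (hA : A.IsPositive) {x : H}
    {r : ℝ} (h : inner ℂ (A x) x = (r : ℂ)) : 0 ≤ r := by
  have := hA.re_inner_nonneg_left x
  rw [h] at this
  exact this

namespace TracialVN

variable (M : TracialVN.{u})

theorem entry_star (T : M.HInf →L[ℂ] M.HInf) (i j : ℤ) :
    M.entry (star T) i j = star (M.entry T j i) := by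
  refine (ContinuousLinearMap.eq_adjoint_iff _ _).2 fun x y => ?_
  have h : inner ℂ ((star T) (lp.single 2 j x) : M.HInf) (lp.single 2 i y : M.HInf) =
      inner ℂ (lp.single 2 j x : M.HInf) (T (lp.single 2 i y)) :=
    ContinuousLinearMap.adjoint_inner_left T _ _
  rwa [lp.inner_single_right, lp.inner_single_left] at h

theorem entryAlg_star (T : M.AlgInf) (i j : ℤ) :
    M.entryAlg (star T) i j = star (M.entryAlg T j i) :=
  Subtype.ext (M.entry_star T.1 i j)

theorem entryAlg_sub (S T : M.AlgInf) (i j : ℤ) :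
    M.entryAlg (S - T) i j = M.entryAlg S i j - M.entryAlg T i j := rfl

theorem entryAlg_smul (c : ℂ) (T : M.AlgInf) (i j : ℤ) :
    M.entryAlg (c • T) i j = c • M.entryAlg T i j := rfl

/-- The element `x ⊗ E_{11}` of `M_∞`. -/
noncomputable def toCorner (x : M.Alg) : M.AlgInf := ⟨M.elem x.1 1 1, M.elem_mem x.2 1 1⟩

theorem toCorner_one : M.toCorner 1 = M.cornerUnit := rfl

theorem fromCorner_toCorner (x : M.Alg) : M.fromCorner (M.toCorner x) = x := by
  have h : ∀ y : M.H, (lp.single 2 1 y : M.HInf) 1 = y :=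
    lp.single_apply_self (E := fun _ => M.H) 2 1
  ext v
  exact (h _).trans (congrArg x.1 (h v))

theorem toCorner_mul (x y : M.Alg) : M.toCorner x * M.toCorner y = M.toCorner (x * y) := by
  refine Subtype.ext (ContinuousLinearMap.ext fun f => ?_)
  have h := congrArg (fun y : M.H => (lp.single 2 1 (x.1 y) : M.HInf))
    (lp.single_apply_self (E := fun _ => M.H) 2 1 (y.1 (f 1)))
  exact h

theorem toCorner_smul (c : ℂ) (x : M.Alg) : M.toCorner (c • x) = c • M.toCorner x := by
  refine Subtype.ext (ContinuousLinearMap.ext fun f => ?_)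
  exact lp.single_smul (E := fun _ => M.H) 2 1 c (x.1 (f 1))

theorem star_toCorner (x : M.Alg) : star (M.toCorner x) = M.toCorner (star x) := by
  refine Subtype.ext ((ContinuousLinearMap.eq_adjoint_iff _ _).2 fun f g => ?_).symm
  change inner ℂ (lp.single 2 1 ((star x.1) (f 1)) : M.HInf) g =
    inner ℂ f (lp.single 2 1 (x.1 (g 1)) : M.HInf)
  rw [lp.inner_single_left, lp.inner_single_right]
  exact ContinuousLinearMap.adjoint_inner_left x.1 _ _

theorem cornerUnit_mul_mul (T : M.AlgInf) :
    M.cornerUnit * T * M.cornerUnit = M.toCorner (M.fromCorner T) := rfl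

theorem entryAlg_mul_cornerUnit_mul (S T : M.AlgInf) (i j : ℤ) :
    M.entryAlg (S * M.cornerUnit * T) i j = M.entryAlg S i 1 * M.entryAlg T 1 j := rfl

theorem inner_entry_star_mul (T : M.AlgInf) (i j : ℤ) (x : M.H) :
    inner ℂ ((star (M.entryAlg T i j) * M.entryAlg T i j : M.Alg).1 x) x =
      ((‖M.entry T.1 i j x‖ ^ 2 : ℝ) : ℂ) := by
  change inner ℂ (ContinuousLinearMap.adjoint (M.entry T.1 i j) (M.entry T.1 i j x)) x = _
  rw [ContinuousLinearMap.adjoint_inner_left, inner_self_eq_norm_sq_to_K]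
  push_cast; rfl

theorem inner_entry_star_mul_self (T : M.AlgInf) (j : ℤ) (x : M.H) :
    inner ℂ ((M.entryAlg (star T * T) j j).1 x) x =
      ((‖T.1 (lp.single 2 j x)‖ ^ 2 : ℝ) : ℂ) := by
  change inner ℂ ((ContinuousLinearMap.adjoint T.1 (T.1 (lp.single 2 j x))) j) x = _
  rw [← lp.inner_single_right, ContinuousLinearMap.adjoint_inner_left, inner_self_eq_norm_sq_to_K]
  push_cast; rfl

/-- The `j`-th column of `T` applied to `x` is a vector of `ℓ²(ℤ; H)`, whose squared norm is the sum
over its coordinates. -/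
theorem hasSum_norm_sq_entry (T : M.AlgInf) (j : ℤ) (x : M.H) :
    HasSum (fun i => ‖M.entry T.1 i j x‖ ^ 2) (‖T.1 (lp.single 2 j x)‖ ^ 2) := by
  have h := lp.hasSum_norm (p := 2) (by norm_num) (T.1 (lp.single 2 j x))
  simp only [ENNReal.toReal_ofNat, Real.rpow_ofNat] at h
  exact h

theorem inner_sum_entry (T : M.AlgInf) (j : ℤ) (F : Finset ℤ) (x : M.H) :
    inner ℂ ((∑ i ∈ F, star (M.entryAlg T i j) * M.entryAlg T i j : M.Alg).1 x) x =
      ((∑ i ∈ F, ‖M.entry T.1 i j x‖ ^ 2 : ℝ) : ℂ) := by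
  rw [AddSubmonoidClass.coe_finsetSum, sum_apply, sum_inner, Complex.ofReal_sum]
  exact Finset.sum_congr rfl fun i _ => M.inner_entry_star_mul T i j x

/-- The diagonal entry `(T* T)_{jj}` is the supremum of the finite partial sums of
`∑_i T_{ij}* T_{ij}`. -/
theorem isLUB_column (T : M.AlgInf) (j : ℤ) :
    IsLUB (Subtype.val '' Set.range fun F : Finset ℤ =>
      ∑ i ∈ F, star (M.entryAlg T i j) * M.entryAlg T i j) (M.entryAlg (star T * T) j j).1 := by
  constructor
  · rintro _ ⟨_, ⟨F, rfl⟩, rfl⟩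
    refine isPositive_of_inner_eq_ofReal _ (fun x => ?_) fun x => sub_nonneg.2 <|
      sum_le_hasSum F (fun i _ => by positivity) (M.hasSum_norm_sq_entry T j x)
    rw [sub_apply, inner_sub_left, inner_entry_star_mul_self, inner_sum_entry, Complex.ofReal_sub]
  · intro B hB
    have hF : ∀ F : Finset ℤ, (B - (∑ i ∈ F, star (M.entryAlg T i j) * M.entryAlg T i j :
        M.Alg).1).IsPositive := fun F => hB ⟨_, ⟨F, rfl⟩, rfl⟩
    -- The empty partial sum shows that an upper bound is positive, so its quadratic form is real.
    have hB0 : B.IsPositive := by simpa using hF ∅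
    have hre : ∀ x, inner ℂ (B x) x = ((inner ℂ (B x) x).re : ℂ) := fun x =>
      ((ContinuousLinearMap.isPositive_iff_complex _).1 hB0 x).1.symm
    refine isPositive_of_inner_eq_ofReal
      (fun x => (inner ℂ (B x) x).re - ‖T.1 (lp.single 2 j x)‖ ^ 2) (fun x => ?_) fun x =>
        sub_nonneg.2 <| hasSum_le_of_sum_le (M.hasSum_norm_sq_entry T j x) fun F =>
          sub_nonneg.1 <| (hF F).nonneg_of_inner_eq_ofReal (x := x) ?_
    · rw [sub_apply, inner_sub_left, inner_entry_star_mul_self, Complex.ofReal_sub, ← hre]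
    · rw [sub_apply, inner_sub_left, inner_sum_entry, Complex.ofReal_sub, ← hre]

/-- Countable additivity of the trace along a column: `τ((T* T)_{jj}) = ∑_i τ(T_{ij}* T_{ij})`. -/
theorem hasSum_tr_column (T : M.AlgInf) (j : ℤ) :
    HasSum (fun i => (M.tr (star (M.entryAlg T i j) * M.entryAlg T i j)).re)
      (M.tr (M.entryAlg (star T * T) j j)).re := by
  refine hasSum_of_isLUB_of_nonneg _ (fun i => (M.tr_nonneg _).1) ?_
  -- Normality applies because the finite partial sums are positive and directed under unions of
  -- index sets.
  have h := M.tr_normal _ _ (Set.range_nonempty _) ?_ ?_ (M.isLUB_column T j)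
  · rw [← Set.range_comp] at h
    simpa [Function.comp_def] using h
  · have mono : ∀ F F' : Finset ℤ, F ⊆ F' →
        (∑ i ∈ F, star (M.entryAlg T i j) * M.entryAlg T i j : M.Alg).1 ≤
        (∑ i ∈ F', star (M.entryAlg T i j) * M.entryAlg T i j : M.Alg).1 := by
      intro F F' hFF
      refine isPositive_of_inner_eq_ofReal _ (fun x => ?_) fun x => sub_nonneg.2 <|
        Finset.sum_le_sum_of_subset_of_nonneg hFF fun i _ _ => sq_nonneg ‖M.entry T.1 i j x‖
      rw [sub_apply, inner_sub_left, inner_sum_entry, inner_sum_entry, Complex.ofReal_sub]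
    classical
    rintro _ ⟨F, rfl⟩ _ ⟨F', rfl⟩
    exact ⟨_, ⟨F ∪ F', rfl⟩, mono _ _ Finset.subset_union_left, mono _ _ Finset.subset_union_right⟩
  · rintro _ ⟨F, rfl⟩
    exact (ContinuousLinearMap.nonneg_iff_isPositive _).2 <| isPositive_of_inner_eq_ofReal _
      (M.inner_sum_entry T j F) fun x => Finset.sum_nonneg fun i _ => sq_nonneg _

/-- By polarization, `4 x = (x + 1)² - (x - 1)²`, and both squares have real trace. -/
theorem tr_im_of_isSelfAdjoint {x : M.Alg} (hx : IsSelfAdjoint x) : (M.tr x).im = 0 := by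
  have h1 := (M.tr_nonneg (x + 1)).2
  have h2 := (M.tr_nonneg (x - 1)).2
  have h3 : star (x + 1) * (x + 1) = star (x - 1) * (x - 1) + (4 : ℂ) • x := by
    rw [star_add, star_sub, hx.star_eq, star_one, show (4 : ℂ) • x = x + x + x + x by module]
    noncomm_ring
  rw [h3, map_add, Complex.add_im, h2, map_smul] at h1
  simpa using h1

/-- The real part of the trace of a diagonal entry. -/
noncomputable def diagTr (T : M.AlgInf) (i : ℤ) : ℝ := (M.tr (M.entryAlg T i i)).re

theorem diagTr_sub (S T : M.AlgInf) (i : ℤ) : M.diagTr (S - T) i = M.diagTr S i - M.diagTr T i := by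
  rw [diagTr, entryAlg_sub, map_sub, Complex.sub_re, diagTr, diagTr]

theorem diagTr_smul (c : ℝ) (T : M.AlgInf) (i : ℤ) :
    M.diagTr ((c : ℂ) • T) i = c * M.diagTr T i := by
  rw [diagTr, entryAlg_smul, map_smul, diagTr]; simp

theorem tr_entryAlg_of_isSelfAdjoint {T : M.AlgInf} (hT : IsSelfAdjoint T) (i : ℤ) :
    M.tr (M.entryAlg T i i) = (M.diagTr T i : ℂ) := by
  refine Complex.ext rfl (M.tr_im_of_isSelfAdjoint ?_)
  rw [isSelfAdjoint_iff, ← entryAlg_star, hT.star_eq]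

theorem trInf_of_isSelfAdjoint {T : M.AlgInf} (hT : IsSelfAdjoint T) :
    M.trInf T = ((∑' i, M.diagTr T i : ℝ) : ℂ) := by
  rw [trInf, Complex.ofReal_tsum]
  exact tsum_congr fun i => M.tr_entryAlg_of_isSelfAdjoint hT i

theorem diagTr_nonneg {p : M.AlgInf} (hp : IsStarProjection p) (i : ℤ) : 0 ≤ M.diagTr p i := by
  have h := M.hasSum_tr_column p i
  rw [hp.isSelfAdjoint.star_eq, hp.isIdempotentElem.eq] at h
  exact h.nonneg fun _ => (M.tr_nonneg _).1

theorem diagTr_mono {p q : M.AlgInf} (hp : IsStarProjection p) (hq : IsStarProjection q)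
    (h : p * q = q) (i : ℤ) : M.diagTr q i ≤ M.diagTr p i := by
  have h' : q * p = q := by
    have := congrArg star h
    rwa [star_mul, hp.isSelfAdjoint.star_eq, hq.isSelfAdjoint.star_eq] at this
  have hpq : IsStarProjection (p - q) := by
    refine ⟨?_, hp.isSelfAdjoint.sub hq.isSelfAdjoint⟩
    change (p - q) * (p - q) = p - q
    rw [mul_sub, sub_mul, sub_mul, h, h', hp.isIdempotentElem.eq, hq.isIdempotentElem.eq,
      sub_self, sub_zero]
  have := M.diagTr_nonneg hpq i
  rw [diagTr_sub] at this
  linarith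

/-- The trace property for a column `u ∈ M_∞ 1_M`: `τ_∞(u u*) = τ(u* u)`. -/
theorem hasSum_diagTr_mul_star {v : M.AlgInf} (hv : v * M.cornerUnit = v) :
    HasSum (M.diagTr (v * star v)) (M.tr (M.fromCorner (star v * v))).re := by
  have h := M.hasSum_tr_column v 1
  -- As `v` is supported on column `1`, `(v v*)_{ii} = v_{i1} v_{i1}*`; traciality on `M` swaps the
  -- factors.
  have key : ∀ i, M.diagTr (v * star v) i =
      (M.tr (star (M.entryAlg v i 1) * M.entryAlg v i 1)).re := fun i => by
    rw [M.tr_mul_comm, ← entryAlg_star, ← entryAlg_mul_cornerUnit_mul, hv, diagTr]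
  rwa [← funext key] at h

end TracialVN
-- Comparing projections of `M` with projections of `M_∞`.
namespace TracialVN

variable {M : TracialVN.{u}}

theorem star_mul_self_eq_toCorner {u : M.AlgInf} (hu : u * M.cornerUnit = u) :
    star u * u = M.toCorner (M.fromCorner (star u * u)) := by
  have h1 : M.cornerUnit * star u = star u := by
    have := congrArg star hu
    rwa [star_mul, ← toCorner_one, star_toCorner, star_one, toCorner_one] at this
  rw [← cornerUnit_mul_mul, ← mul_assoc, h1, mul_assoc, hu]

theorem star_mul_self_ne_zero {u : M.AlgInf} (hu : u ≠ 0) : star u * u ≠ 0 := fun h => hu <|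
  Subtype.ext <| (CStarRing.star_mul_self_eq_zero_iff (u.1)).1 (congrArg Subtype.val h)

/-- If a projection `e` with scalar corner is connected to a projection `p ∈ M_∞` by a nonzero
element `u ∈ p M_∞ e`, then `τ(e) ≤ τ_∞(p)`. -/
theorem tr_le_tsum_diagTr_of_ne_zero {e : M.Alg} (he : IsStarProjection e)
    (hmin : ∀ b, IsSelfAdjoint b → b * e = b → e * b = b → ∃ c : ℝ, b = (c : ℂ) • e)
    {p : M.AlgInf} (hp : IsStarProjection p) (hps : Summable (M.diagTr p)) {u : M.AlgInf}
    (hu0 : u ≠ 0) (hpu : p * u = u) (hue : u * M.toCorner e = u) :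
    (M.tr e).re ≤ ∑' i, M.diagTr p i := by
  have hu : u * M.cornerUnit = u := by
    rw [← hue, mul_assoc, ← toCorner_one, toCorner_mul, mul_one]
  set b := M.fromCorner (star u * u) with hb
  have hub : star u * u = M.toCorner b := star_mul_self_eq_toCorner hu
  have hbs : IsSelfAdjoint b := by
    rw [isSelfAdjoint_iff, ← M.fromCorner_toCorner (star b), ← star_toCorner, ← hub, star_mul,
      star_star]
  have hbe : b * e = b := by
    rw [← M.fromCorner_toCorner (b * e), ← toCorner_mul, ← hub, mul_assoc, hue]
  have heb : e * b = b := by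
    have := congrArg star hbe
    rwa [star_mul, hbs.star_eq, he.isSelfAdjoint.star_eq] at this
  obtain ⟨c, hc⟩ := hmin b hbs hbe heb
  have hsum := M.hasSum_diagTr_mul_star hu
  rw [← hb, hc, map_smul, smul_eq_mul, Complex.re_ofReal_mul] at hsum
  have hc0 : c ≠ 0 := by
    rintro rfl
    refine star_mul_self_ne_zero hu0 ?_
    rw [hub, hc, toCorner_smul]; simp
  have hcC : (c : ℂ) ≠ 0 := by exact_mod_cast hc0
  -- From `u* u = c e` and `u e = u` it follows that `(u u*)² = c u u*`.
  have hg : IsStarProjection (((c⁻¹ : ℝ) : ℂ) • (u * star u)) := by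
    refine ⟨?_, ?_⟩
    · have : u * star u * (u * star u) = (c : ℂ) • (u * star u) := by
        rw [mul_assoc, ← mul_assoc (star u), hub, hc, toCorner_smul, smul_mul_assoc,
          mul_smul_comm, ← mul_assoc, hue]
      change _ * _ = _
      rw [smul_mul_smul_comm, this, smul_smul]
      congr 1; push_cast; field_simp
    · rw [isSelfAdjoint_iff, star_smul, star_mul, star_star]
      simp
  have hle := fun i => M.diagTr_mono hp hg (by rw [mul_smul_comm, ← mul_assoc, hpu]) i
  have hsum' := hsum.mul_left c⁻¹
  rw [inv_mul_cancel_left₀ hc0] at hsum'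
  exact hasSum_le hle (hsum'.congr_fun fun i => M.diagTr_smul _ _ i) hps.hasSum

/-- If `P` is a sum of mutually equivalent projections with matrix units `E s t` and `w` is a
partial isometry in `P M_∞ 1_M`, then `τ(w* w)` is at most the size of a matrix representation
of `M` times the trace of any of these projections. -/
theorem tr_initial_le {ι : Type*} [Fintype ι] {n : ℕ} {f : M.Alg →⋆ₐ[ℂ] Matrix (Fin n) (Fin n) ℂ}
    (hf : Function.Injective f) {P w : M.AlgInf} (hw : M.IsCornerPartialIsometry P w)
    (E : ι → ι → M.AlgInf) (hE : ∀ r s t, E r s * E s t = E r t) (hEs : ∀ s t, star (E s t) = E t s)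
    (hP : ∑ s, E s s = P) (o : ι) (hs : Summable (M.diagTr (E o o))) :
    (M.tr (M.fromCorner (star w * w))).re ≤ n * ∑' i, M.diagTr (E o o) i := by
  obtain ⟨hww, hPw, hw1⟩ := hw
  have hproj : IsStarProjection (E o o) := ⟨hE o o o, hEs o o⟩
  have ht : 0 ≤ ∑' i, M.diagTr (E o o) i := tsum_nonneg (M.diagTr_nonneg hproj)
  set Q := M.fromCorner (star w * w) with hQ
  have hwQ : star w * w = M.toCorner Q := star_mul_self_eq_toCorner hw1
  have hQQ : Q * Q = Q := by
    rw [← M.fromCorner_toCorner (Q * Q), ← toCorner_mul, ← hwQ, mul_assoc, ← mul_assoc w, hww]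
  have hQs : IsSelfAdjoint Q := by
    rw [isSelfAdjoint_iff, ← M.fromCorner_toCorner (star Q), ← star_toCorner, ← hwQ, star_mul,
      star_star]
  let τ : M.Alg →+ ℝ := Complex.reAddGroupHom.comp M.tr.toAddMonoidHom
  have main := le_rank_mul_of_exists_subprojection hf τ (∑' i, M.diagTr (E o o) i) (Q := Q) ?_ ht
    Q ⟨hQQ, hQs⟩ hQQ
  · refine main.trans (mul_le_mul_of_nonneg_right ?_ ht)
    exact_mod_cast (Matrix.rank_le_card_width _).trans_eq (Fintype.card_fin n)
  intro q hq hq0 hQq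
  obtain ⟨e, he, he0, hqe, hmin⟩ := exists_minimal_projection hf hq hq0
  refine ⟨e, he, he0, hqe, ?_⟩
  have hQe : Q * e = e := by rw [← hqe, ← mul_assoc, hQq]
  -- Since `e ≤ Q = w* w`, the element `w e` is a partial isometry with initial projection `e`,
  -- hence nonzero.
  have hwe : star (w * M.toCorner e) * (w * M.toCorner e) = M.toCorner e := by
    rw [star_mul, mul_assoc, ← mul_assoc (star w), hwQ, toCorner_mul, hQe, star_toCorner,
      toCorner_mul, he.isSelfAdjoint.star_eq, he.isIdempotentElem.eq]
  have hwe0 : w * M.toCorner e ≠ 0 := fun h => he0 <| by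
    rw [h, mul_zero] at hwe
    rw [← M.fromCorner_toCorner e, ← hwe]; rfl
  obtain ⟨s, hs0⟩ : ∃ s, E s s * (w * M.toCorner e) ≠ 0 := by
    by_contra! h
    refine hwe0 ?_
    rw [← hPw, ← hP, mul_assoc, Finset.sum_mul]
    exact Finset.sum_eq_zero fun s _ => h s
  -- The matrix unit `E o s` moves the nonzero block into the fixed projection `E o o`; multiplying
  -- back by `E s o` shows that nothing is lost.
  refine tr_le_tsum_diagTr_of_ne_zero he hmin hproj hs (u := E o s * (w * M.toCorner e))
    (fun h => hs0 ?_) ?_ ?_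
  · rw [← hE s o s, mul_assoc, h, mul_zero]
  · rw [← mul_assoc, hE]
  · rw [mul_assoc, mul_assoc, toCorner_mul, he.isIdempotentElem.eq]

/-- `τ_∞(P - w w*) = τ_∞(P) - τ(w* w)` for a partial isometry `w ∈ P M_∞ 1_M`. -/
theorem trInf_sub_final {P w : M.AlgInf} (hP : IsStarProjection P) (hPs : Summable (M.diagTr P))
    (hw : M.IsCornerPartialIsometry P w) :
    M.trInf (P - w * star w) =
      ((∑' i, M.diagTr P i - (M.tr (M.fromCorner (star w * w))).re : ℝ) : ℂ) := by
  have hs := M.hasSum_diagTr_mul_star hw.2.2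
  have hsa : IsSelfAdjoint (P - w * star w) := hP.isSelfAdjoint.sub (IsSelfAdjoint.mul_star_self w)
  rw [M.trInf_of_isSelfAdjoint hsa, ← (hPs.hasSum.sub hs).tsum_eq]
  simp only [diagTr_sub]

end TracialVN

open TracialVN

/-! ### The dimension bound. -/

theorem qubitTr_single (k : ℕ) (N : TracialVN.{u}) (s : Idx k) :
    qubitTr k N (Matrix.single s s 1) = (2 ^ k : ℂ)⁻¹ := by
  rw [qubitTr, Matrix.trace_single_eq_same, N.tr_one, mul_one]

theorem qubitTr_one (k : ℕ) (N : TracialVN.{u}) : qubitTr k N 1 = 1 := by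
  rw [qubitTr, Matrix.trace_one, ← nsmul_one, map_nsmul, N.tr_one]
  simp

/-- The dimension bound given by an identification of `M_{2^k}(N)` with `P M_∞ P` and a partial
isometry `w ∈ P M_∞ 1_M` with `τ_∞(P - w w*) ≤ δ τ_∞(P)`. -/
theorem two_pow_mul_le_of_corner_iso {M N : TracialVN.{u}} {k n : ℕ} {δ : ℝ}
    {f : M.Alg →⋆ₐ[ℂ] Matrix (Fin n) (Fin n) ℂ} (hf : Function.Injective f) {P w : M.AlgInf}
    (θ : QubitAlg k N →⋆ₙₐ[ℂ] M.AlgInf) (hP : M.IsFiniteProj P)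
    (hr : Set.range θ = {T | ∃ T₀, T = P * T₀ * P})
    (hτ : ∀ r, qubitTr k N r = M.trInf (θ r) / M.trInf P)
    (hw : M.IsCornerPartialIsometry P w)
    (hδ : (M.trInf (P - w * star w) / M.trInf P).re ≤ δ) : 2 ^ k * (1 - δ) ≤ n := by
  obtain ⟨hPp, hPsum⟩ := hP
  have hPs : Summable (M.diagTr P) := by
    simpa only [tr_entryAlg_of_isSelfAdjoint M hPp.isSelfAdjoint, Complex.summable_ofReal]
      using hPsum
  -- The map `θ` is not assumed unital into `M_∞`, but `θ 1` is a unit for its range `P M_∞ P`,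
  -- which contains `P`.
  have hθ1 : θ 1 = P := by
    obtain ⟨r, hr'⟩ : P ∈ Set.range θ := by
      rw [hr]; exact ⟨P, by rw [hPp.isIdempotentElem.eq, hPp.isIdempotentElem.eq]⟩
    obtain ⟨T, hT⟩ : θ 1 ∈ {T | ∃ T₀, T = P * T₀ * P} := hr ▸ ⟨1, rfl⟩
    calc θ 1 = θ 1 * P := by rw [hT, mul_assoc (P * T), hPp.isIdempotentElem.eq]
      _ = P := by rw [← hr', ← map_mul, one_mul]
  set Λ := ∑' i, M.diagTr P i with hΛ
  have hΛP : M.trInf P = (Λ : ℂ) := M.trInf_of_isSelfAdjoint hPp.isSelfAdjoint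
  -- If `Λ = 0`, the quotient defining the normalized trace would be `0` by the convention for
  -- division, whereas the trace of `1` is `1`.
  have hΛ0 : 0 < Λ := by
    refine lt_of_le_of_ne (tsum_nonneg (M.diagTr_nonneg hPp)) fun h => ?_
    have := hτ 1
    rw [qubitTr_one, hΛP, ← h] at this
    simp at this
  let E : Idx k → Idx k → M.AlgInf := fun s t => θ (Matrix.single s t 1)
  have hE : ∀ r s t, E r s * E s t = E r t := fun r s t => by
    change θ _ * θ _ = θ _
    rw [← map_mul, Matrix.single_mul_single_same, mul_one]
  have hEs : ∀ s t, star (E s t) = E t s := fun s t => by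
    change star (θ _) = θ _
    rw [← map_star, Matrix.star_eq_conjTranspose, Matrix.conjTranspose_single, star_one]
  have hEP : ∑ s, E s s = P := by
    rw [← hθ1, ← Matrix.sum_single_one, map_sum]
  let o : Idx k := 0
  have ho : IsStarProjection (E o o) := ⟨hE o o o, hEs o o⟩
  have hos : Summable (M.diagTr (E o o)) :=
    Summable.of_nonneg_of_le (M.diagTr_nonneg ho)
      (M.diagTr_mono hPp ho (by rw [← hθ1]; change θ _ * θ _ = θ _; rw [← map_mul, one_mul])) hPs
  have ht : ∑' i, M.diagTr (E o o) i = (2 ^ k)⁻¹ * Λ := by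
    have := hτ (Matrix.single o o 1)
    rw [qubitTr_single, hΛP, eq_div_iff (by exact_mod_cast hΛ0.ne'),
      show θ (Matrix.single o o 1) = E o o from rfl,
      M.trInf_of_isSelfAdjoint ho.isSelfAdjoint] at this
    exact Complex.ofReal_injective (by rw [← this]; simp)
  have h1 := tr_initial_le hf hw E hE hEs hEP o hos
  rw [trInf_sub_final hPp hPs hw, hΛP, ← Complex.ofReal_div, Complex.ofReal_re, div_le_iff₀ hΛ0] at hδ
  rw [ht] at h1
  -- Both sides are compared with `τ(w* w)`: from below by `hδ`, from above by `h1`.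
  have h2 : (1 - δ) * Λ ≤ n * (2 ^ k)⁻¹ * Λ := by linarith
  have h3 := le_of_mul_le_mul_right h2 hΛ0
  rw [← div_eq_mul_inv, le_div_iff₀ (by positivity)] at h3
  linarith

/-- With no faithful matrix representation the infimum defining `dim` is over the empty set, hence
`⊤`, so the infinite-dimensional case is covered too. -/
theorem TracialVN.le_dim {M : TracialVN.{u}} {m : ℝ}
    (h : ∀ (n : ℕ) (f : M.Alg →⋆ₐ[ℂ] Matrix (Fin n) (Fin n) ℂ), Function.Injective f → m ≤ n) :
    ENNReal.ofReal m ≤ ((M.dim : ℕ∞) : ENNReal) := by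
  -- Rounding `m` up costs nothing, since dimensions are integers.
  have h1 : ((⌈m⌉₊ : ℕ) : ℕ∞) ≤ M.dim := by
    refine le_iInf₂ fun n hn => ?_
    obtain ⟨f, hf⟩ := hn
    exact_mod_cast Nat.ceil_le.2 (h n f hf)
  calc ENNReal.ofReal m ≤ ((⌈m⌉₊ : ℕ) : ENNReal) := ENNReal.ofReal_le_of_le_toReal (by
        simpa using Nat.le_ceil m)
    _ = (((⌈m⌉₊ : ℕ) : ℕ∞) : ENNReal) := by simp
    _ ≤ _ := by exact_mod_cast h1

end QubitTest

open QubitTest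
theorem mainTheorem4 :
    ∃ C : ℝ, 0 < C ∧
      ∀ (k : ℕ) (δ : unitInterval → ℝ≥0) (𝒳 : Type v) [Fintype 𝒳]
        (𝒜 : 𝒳 → Type w) [∀ x, Fintype (𝒜 x)] (G : Game 𝒳 𝒜),
        Game.IsQubitTest.{u} G k δ →
        ∀ (M : TracialVN.{u}) (A : SyncStrategy 𝒜 M.Alg) (ε : unitInterval),
          G.value M.tr A = 1 - (ε : ℝ) →
          δ ε < 1 →
          ENNReal.ofReal
              ((1 + C * Real.sqrt (δ ε) + (δ ε : ℝ) / (1 - (δ ε : ℝ)))⁻¹ * 2 ^ k) ≤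
            (M.dim : ℝ≥0∞) := by
  -- Any positive constant works, as the bound already holds without the `√δ` term.
  refine ⟨1, one_pos, ?_⟩
  intro k δ 𝒳 _ 𝒜 _ G hG M A ε hval hδ
  obtain ⟨-, S, φ, e, -, -, -, hsound⟩ := hG
  obtain ⟨N, B, -, P, w, θ, hP, -, hr, hτ, hw, -, -, hδ'⟩ := hsound M A ε hval
  have hd : 0 < 1 - (δ ε : ℝ) := sub_pos.2 (by exact_mod_cast hδ)
  refine TracialVN.le_dim fun n f hf => le_trans ?_
    (two_pow_mul_le_of_corner_iso hf θ hP hr hτ hw hδ')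
  rw [mul_comm]
  refine mul_le_mul_of_nonneg_left ?_ (by positivity)
  refine inv_le_of_inv_le₀ hd ?_
  have h1 : (1 - (δ ε : ℝ))⁻¹ = 1 + (δ ε : ℝ) / (1 - (δ ε : ℝ)) := by field_simp; ring
  rw [h1, one_mul]
  linarith [Real.sqrt_nonneg (δ ε : ℝ)]
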